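/- For $N\ge 0$ let $\mathcal I_N : C([-1,1])\to C([-1,1])$ be Chebyshev interpolation of degree $N$: $\mathcal I_N f$ is the polynomial of degree at most $N$ that agrees with $f$ in the $N+1$ Chebyshev nodes $t_i=\cos\bigl((2i-1)\pi/(2(N+1))\bigr)$, $i=1,\dots,N+1$. Let $\Lambda_N=\|\mathcal I_N\|$ be its operator norm with respect to the sup norm on $C([-1,1])$ (the Lebesgue constant). For $N_1,\dots,N_m\ge 0$ let $\mathcal I_{N_1}\otimes\dots\otimes\mathcal I_{N_m}$ be the tensorized interpolation operator on functions on $[-1,1]^m$, that is, $$(\mathcal I_{N_1}\otimes\dots\otimes\mathcal I_{N_m})f\,(x)=\sum_{i_1=1}^{N_1+1}\cdots\sum_{i_m=1}^{N_m+1} f\bigl(t^{(1)}_{i_1},\dots,t^{(m)}_{i_m}\bigr)\,\ell^{(1)}_{i_1}(x_1)\cdots\ell^{(m)}_{i_m}(x_m),$$ where $t^{(k)}_i$ are the $N_k+1$ Chebyshev nodes in direction $k$ and $\ell^{(k)}_i$ their Lagrange basis polynomials. Corollary. Let $g:[-1,1]^m\to\mathbb R$, and let $\rho_k>1$ and $C_k\in\mathbb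 R$ for $k=1,\dots,m$. Assume that for every $k$, and for all values in $[-1,1]$ of the other arguments, $g$ as a function of its $k$th argument has an analytic continuation to the open region inside the Bernstein ellipse $\{(\rho_k e^{i\theta}+\rho_k^{-1}e^{-i\theta})/2 : \theta\in\mathbb R\}$ whose modulus is bounded there by $C_k$. Let $\hat g=(\mathcal I_{N_1}\otimes\dots\otimes\mathcal I_{N_m})(g+e)$, where $e:[-1,1]^m\to\mathbb R$ represents an evaluation error, and let $\|e\|_\infty$ be the maximum of $|e|$ over the grid of interpolation nodes (which is at most the supremum of $|e|$ over $[-1,1]^m$). Then $$\sup_{x\in[-1,1]^m}|g(x)-\hat g(x)|\le\sum_{k=1}^m\frac{4\,\Lambda_{N_1}\cdots\Lambda_{N_{k-1}}\,C_k}{(\rho_k-1)\rho_k^{N_k}}+\Lambda_{N_1}\cdots\Lambda_{N_m}\|e\|_\infty,$$ where $\Lambda_N\le\frac2\pi\log(N+1)+1$ for every $N\ge 0$. In particular, if $N_1=\dots=N_m=N\ge 1$, $\rho_1=\dots=\rho_m=\rho$ and $C_1=\dots=C_m=C$, then $\Lambda_N>1$ and $$\sup_{x\in[-1,1]^m}|g(x)-\hat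 g(x)|\le\frac{4(\Lambda_N^m-1)\,C}{(\rho-1)\rho^N(\Lambda_N-1)}+\Lambda_N^m\|e\|_\infty.$$ -/

import Mathlib

open scoped BigOperators

noncomputable section

namespace ChebInterp

/-- The interval `[-1, 1]`. The cube `[-1, 1]^m` is `Fin m → I`. -/
abbrev I : Type := Set.Icc (-1 : ℝ) 1

/-- The Chebyshev nodes `cos ((2 i - 1) π / (2 (N + 1)))`, `i = 1, …, N + 1`
(with `i` shifted so that it starts at `0`). -/
def node (N : ℕ) (i : Fin (N + 1)) : I :=
  ⟨Real.cos ((2 * ((i : ℕ) : ℝ) + 1) * Real.pi / (2 * ((N : ℝ) + 1))),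
    Real.neg_one_le_cos _, Real.cos_le_one _⟩

/-- The Lagrange basis polynomials of the `N + 1` Chebyshev nodes, as functions on `[-1, 1]`. -/
def basis (N : ℕ) (i : Fin (N + 1)) : C(I, ℝ) :=
  (Lagrange.basis Finset.univ (fun j : Fin (N + 1) => (node N j : ℝ)) i).toContinuousMapOn
    (Set.Icc (-1 : ℝ) 1)

/-- Univariate Chebyshev interpolation of degree `N`: the operator on `C([-1, 1])` that maps `f`
to the polynomial of degree at most `N` that agrees with `f` in the `N + 1` Chebyshev nodes. -/
def interp (N : ℕ) : C(I, ℝ) →L[ℝ] C(I, ℝ) :=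
  ∑ i : Fin (N + 1), (ContinuousMap.evalCLM ℝ (node N i)).smulRight (basis N i)

/-- The Lebesgue constant `Λ_N`: the operator norm of degree-`N` Chebyshev interpolation with
respect to the sup norm on `C([-1, 1])`. -/
def lebesgueConst (N : ℕ) : ℝ := ‖interp N‖

/-- The points of the tensor grid of Chebyshev nodes, with `N k + 1` nodes in direction `k`. -/
def grid {m : ℕ} (N : Fin m → ℕ) (i : (k : Fin m) → Fin (N k + 1)) : Fin m → I :=
  fun k => node (N k) (i k)

/-- Tensorized Chebyshev interpolation `I_{N 1} ⊗ ⋯ ⊗ I_{N m}` of a function on `[-1, 1]^m`. -/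
def tensorInterp {m : ℕ} (N : Fin m → ℕ) (f : (Fin m → I) → ℝ) : (Fin m → I) → ℝ :=
  fun x => ∑ i : (k : Fin m) → Fin (N k + 1), f (grid N i) * ∏ k, basis (N k) (i k) (x k)

/-- The region inside the Bernstein ellipse `{(ρ e^{iθ} + ρ⁻¹ e^{-iθ}) / 2}`, as the union of the
confocal ellipses with parameter `r = ‖w‖`, `1 ≤ r < ρ` (for `r = 1` this is the segment
`[-1, 1]`). -/
def bernsteinEllipse (ρ : ℝ) : Set ℂ :=
  (fun w : ℂ => (w + w⁻¹) / 2) '' {w : ℂ | 1 ≤ ‖w‖ ∧ ‖w‖ < ρ}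

/-- `g` is analytic in its `k`th argument, the others being fixed in `[-1, 1]`, with an analytic
continuation inside the Bernstein ellipse with parameter `ρ` that is bounded there by `C`. -/
def HasBoundedContinuation {m : ℕ} (g : (Fin m → I) → ℝ) (k : Fin m) (ρ C : ℝ) : Prop :=
  ∀ x : Fin m → I, ∃ G : ℂ → ℂ,
    AnalyticOnNhd ℂ G (bernsteinEllipse ρ) ∧
    (∀ z ∈ bernsteinEllipse ρ, ‖G z‖ ≤ C) ∧
    ∀ t : I, G ((t : ℝ) : ℂ) = ((g (Function.update x k t) : ℝ) : ℂ)

end ChebInterp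

end

noncomputable section

namespace ChebInterp

open Real Polynomial MeasureTheory

/-! In one variable, put x = cos θ. Continuation to the Bernstein ellipse makes the Fourier
coefficients of θ ↦ G(cos θ) decay like C ρ^(-|n|) (`norm_fourierCoeff_cosLift_le`). Interpolation
fixes cos nθ for |n| ≤ N and, by aliasing, sends every other one to a function bounded by 1. The
error is thus at most 2C times the two-sided geometric tail (`abs_sub_sum_basis_le`).

In m variables, g - Ig = (g - I₁g) + I₁(g - I'g), where I₁ acts on the first variable and I' on the
rest. Iterating yields the products of Lebesgue constants (`abs_sub_tensorInterp_le`); the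
evaluation error enters by linearity.

For the bound on Λ_N, the Lebesgue function is dominated by |cos((N+1)θ)| times a sum of |cot|. This
majorant is largest at θ = 0 (`abs_cos_mul_sum_abs_cot_le`), where cot x ≤ 1/x - x/3 leaves an odd
harmonic sum (`lebesgueConst_le_log`). -/

/-! ### Cotangent sums are maximal at the origin -/

/-- This is the monotonicity of sin(nt)/sin t for nt ≤ π/2, with denominators cleared so that the
addition formulas give an induction. -/
lemma sin_mul_sin_nat_mul_le {u v : ℝ} (hu : 0 ≤ u) (huv : u ≤ v) (n : ℕ)
    (hv : n * v ≤ π / 2) : sin u * sin (n * v) ≤ sin v * sin (n * u) := by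
  induction n with
  | zero => simp
  | succ n ih =>
    rcases n.eq_zero_or_pos with rfl | hn
    · simp [mul_comm]
    have hπ := pi_pos
    have hn1 : (1 : ℝ) ≤ n := by exact_mod_cast hn
    push_cast at hv ⊢
    have hv0 : 0 ≤ v := hu.trans huv
    have hnv : n * v ≤ π / 2 := by nlinarith
    have hvv : v ≤ π / 2 := by nlinarith
    have hnu : n * u ≤ n * v := by nlinarith
    have hnu0 : 0 ≤ n * u := by positivity
    have h := ih hnv
    have hsu : 0 ≤ sin u := sin_nonneg_of_nonneg_of_le_pi hu (by linarith)
    have hsv : sin u ≤ sin v := sin_le_sin_of_le_of_le_pi_div_two (by linarith) hvv huv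
    have hc : cos v ≤ cos u := cos_le_cos_of_nonneg_of_le_pi hu (by linarith) huv
    have hcn : cos (n * v) ≤ cos (n * u) :=
      cos_le_cos_of_nonneg_of_le_pi hnu0 (by linarith) hnu
    have hcv : 0 ≤ cos v := cos_nonneg_of_mem_Icc ⟨by linarith, hvv⟩
    have hsnu : 0 ≤ sin (n * u) := sin_nonneg_of_nonneg_of_le_pi hnu0 (by linarith)
    rw [add_mul, add_mul, one_mul, one_mul, sin_add, sin_add]
    have h1 : sin u * sin (n * v) * cos v ≤ sin v * sin (n * u) * cos u :=
      (mul_le_mul_of_nonneg_right h hcv).trans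
        (mul_le_mul_of_nonneg_left hc (mul_nonneg (hsu.trans hsv) hsnu))
    have h2 : sin u * sin v * cos (n * v) ≤ sin u * sin v * cos (n * u) :=
      mul_le_mul_of_nonneg_left hcn (mul_nonneg hsu (hsu.trans hsv))
    linarith

/-- The two cotangents add up to sin 2x / (sin² x - sin² u), so the claim reduces to sin² u ≤ 2 sin²
x sin²(nu). This follows from `sin_mul_sin_nat_mul_le` with v = π/(4n), where sin(nv) = √2/2. -/
lemma cos_mul_abs_cot_add_le {n : ℕ} (hn : 0 < n) {u x : ℝ} (hu : |u| ≤ π / (4 * n))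
    (hx : π / (4 * n) ≤ x) (hx' : x ≤ π / 2 - π / (4 * n)) :
    cos (2 * n * u) * (|cot (u + x)| + |cot (u - x)|) ≤ 2 * cot x := by
  have hπ := pi_pos
  have hn' : (0 : ℝ) < n := by exact_mod_cast hn
  set h := π / (4 * n) with hh
  have h0 : 0 < h := by positivity
  have hnh : n * h = π / 4 := by rw [hh]; field_simp
  wlog hu0 : 0 ≤ u generalizing u with H
  · have := H (u := -u) (by rwa [abs_neg]) (by linarith)
    rw [mul_neg, cos_neg] at this
    rw [show u + x = -(-u - x) by ring, show u - x = -(-u + x) by ring]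
    have hc (y : ℝ) : |cot (-y)| = |cot y| := by
      rw [cot_eq_cos_div_sin, cot_eq_cos_div_sin, cos_neg, sin_neg, div_neg, abs_neg]
    rw [hc, hc, add_comm |cot _|]
    exact this
  rw [abs_of_nonneg hu0] at hu
  have hcx : 0 ≤ cot x := by
    rw [cot_eq_cos_div_sin]
    exact div_nonneg (cos_nonneg_of_mem_Icc ⟨by linarith, by linarith⟩)
      (sin_nonneg_of_nonneg_of_le_pi (by linarith) (by linarith))
  -- At u = π/(4n) the point u - x may be a pole of cot; the cosine factor vanishes there.
  rcases hu.eq_or_lt with rfl | hlt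
  · rw [mul_assoc, hnh, show 2 * (π / 4) = π / 2 by ring, cos_pi_div_two, zero_mul]
    linarith
  have hs1 : 0 < sin (x + u) := sin_pos_of_pos_of_lt_pi (by linarith) (by linarith)
  have hs2 : 0 < sin (x - u) := sin_pos_of_pos_of_lt_pi (by linarith) (by linarith)
  have hsx : 0 < sin x := sin_pos_of_pos_of_lt_pi (by linarith) (by linarith)
  have hcosx : 0 ≤ cos x := cos_nonneg_of_mem_Icc ⟨by linarith, by linarith⟩
  have e1 : |cot (u + x)| = cos (x + u) / sin (x + u) := by
    rw [add_comm, cot_eq_cos_div_sin, abs_of_nonneg]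
    exact div_nonneg (cos_nonneg_of_mem_Icc ⟨by linarith, by linarith⟩) hs1.le
  have e2 : |cot (u - x)| = cos (x - u) / sin (x - u) := by
    rw [← neg_sub, cot_eq_cos_div_sin, cos_neg, sin_neg, div_neg, abs_neg, abs_of_nonneg]
    exact div_nonneg (cos_nonneg_of_mem_Icc ⟨by linarith, by linarith⟩) hs2.le
  have e3 : cos (x + u) / sin (x + u) + cos (x - u) / sin (x - u)
      = 2 * sin x * cos x / (sin (x + u) * sin (x - u)) := by
    rw [div_add_div _ _ hs1.ne' hs2.ne']
    congr 1
    rw [← sin_two_mul, show 2 * x = (x + u) + (x - u) by ring, sin_add (x + u)]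
    ring
  have e4 : sin (x + u) * sin (x - u) = sin x ^ 2 - sin u ^ 2 := by
    rw [sin_add, sin_sub]
    linear_combination sin x ^ 2 * cos_sq' u - sin u ^ 2 * cos_sq' x
  rw [e1, e2, e3, cot_eq_cos_div_sin, mul_div_assoc', mul_div_assoc',
    div_le_div_iff₀ (mul_pos hs1 hs2) hsx, e4]
  have k1 := sin_mul_sin_nat_mul_le hu0 hu n (by rw [hnh]; linarith)
  rw [hnh, sin_pi_div_four] at k1
  have hsu : 0 ≤ sin u := sin_nonneg_of_nonneg_of_le_pi hu0 (by linarith)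
  have hnu : n * u ≤ π / 4 := hnh ▸ mul_le_mul_of_nonneg_left hu hn'.le
  have hsnu : 0 ≤ sin (n * u) :=
    sin_nonneg_of_nonneg_of_le_pi (by positivity) (by linarith)
  have k2 : sin h ≤ sin x := sin_le_sin_of_le_of_le_pi_div_two (by linarith) (by linarith) hx
  have k3 : sin u * (√2 / 2) ≤ sin x * sin (n * u) :=
    k1.trans (mul_le_mul_of_nonneg_right k2 hsnu)
  have k4 : sin u ^ 2 ≤ 2 * (sin x ^ 2 * sin (n * u) ^ 2) := by
    have := pow_le_pow_left₀ (by positivity) k3 2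
    rw [mul_pow, mul_pow, div_pow, sq_sqrt (by norm_num)] at this
    linarith
  have k5 : cos (2 * n * u) = 1 - 2 * sin (n * u) ^ 2 := by
    rw [mul_assoc, cos_two_mul, cos_sq']; ring
  have k6 : cos (2 * n * u) * sin x ^ 2 ≤ sin x ^ 2 - sin u ^ 2 := by
    rw [k5]; linarith
  have := mul_le_mul_of_nonneg_left k6 (mul_nonneg two_pos.le hcosx)
  linarith

lemma cot_add_pi (x : ℝ) : cot (x + π) = cot x := by
  rw [cot_eq_cos_div_sin, cot_eq_cos_div_sin, cos_add_pi, sin_add_pi, neg_div_neg_eq]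

/-- The 2n shifts ±(2i+1)π/(4n) are equally spaced modulo π, the period of cot, so a translation by
one step permutes them. The proof telescopes. -/
lemma periodic_sum_abs_cot {n : ℕ} (hn : 0 < n) :
    Function.Periodic (fun v : ℝ => ∑ i ∈ Finset.range n,
      (|cot (v + (2 * i + 1) * π / (4 * n))| + |cot (v - (2 * i + 1) * π / (4 * n))|))
      (π / (2 * n)) := by
  intro v
  have hn' : (n : ℝ) ≠ 0 := by exact_mod_cast hn.ne'
  have key := Finset.sum_range_sub (fun i : ℕ =>
    |cot (v + (2 * i + 1) * π / (4 * n))| - |cot (v - (2 * i - 1) * π / (4 * n))|) n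
  have h0 : |cot (v + (2 * (n : ℝ) + 1) * π / (4 * n))|
      = |cot (v - (2 * (n : ℝ) - 1) * π / (4 * n))| := by
    rw [← cot_add_pi (v - _)]
    congr 2
    field_simp
    ring
  have h1 : |cot (v + (2 * ((0 : ℕ) : ℝ) + 1) * π / (4 * n))|
      = |cot (v - (2 * ((0 : ℕ) : ℝ) - 1) * π / (4 * n))| := by
    congr 2
    push_cast
    ring
  simp only [h0, h1, sub_self] at key
  rw [← sub_eq_zero, ← Finset.sum_sub_distrib, ← key]
  refine Finset.sum_congr rfl fun i _ => ?_
  have a1 : v + π / (2 * n) + (2 * i + 1) * π / (4 * n)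
      = v + (2 * ((i + 1 : ℕ) : ℝ) + 1) * π / (4 * n) := by
    push_cast; field_simp; ring
  have a2 : v + π / (2 * n) - (2 * i + 1) * π / (4 * n)
      = v - (2 * i - 1) * π / (4 * n) := by
    field_simp; ring
  have a3 : v - (2 * i + 1) * π / (4 * n)
      = v - (2 * ((i + 1 : ℕ) : ℝ) - 1) * π / (4 * n) := by
    push_cast; ring
  rw [a1, a2, a3]
  ring

/-- Both factors on the left have period π/(2n), so v can be moved to its representative nearest 0,
where the bound holds term by term. -/
lemma abs_cos_mul_sum_abs_cot_le {n : ℕ} (hn : 0 < n) (v : ℝ) :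
    |cos (2 * n * v)| * ∑ i ∈ Finset.range n,
      (|cot (v + (2 * i + 1) * π / (4 * n))| + |cot (v - (2 * i + 1) * π / (4 * n))|)
    ≤ 2 * ∑ i ∈ Finset.range n, cot ((2 * i + 1) * π / (4 * n)) := by
  have hπ := pi_pos
  have hn' : (0 : ℝ) < n := by exact_mod_cast hn
  set p : ℤ := round (v / (π / (2 * n))) with hp
  set u : ℝ := v - p * (π / (2 * n)) with hu
  have hu' : |u| ≤ π / (4 * n) := by
    have h1 := abs_sub_round (v / (π / (2 * n)))
    rw [← hp] at h1
    have h2 : u = (v / (π / (2 * n)) - p) * (π / (2 * n)) := by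
      rw [hu]; field_simp
    rw [h2, abs_mul, abs_of_pos (show 0 < π / (2 * n) by positivity)]
    calc _ ≤ 1 / 2 * (π / (2 * n)) := by gcongr
      _ = _ := by field_simp; norm_num
  have hA := (periodic_sum_abs_cot hn).sub_int_mul_eq (x := v) p
  rw [← hA, ← hu]
  have hc : |cos (2 * n * v)| = |cos (2 * n * u)| := by
    have : 2 * n * u = 2 * n * v - p * π := by rw [hu]; field_simp
    rw [this, cos_sub_int_mul_pi, abs_mul, abs_zpow, abs_neg, abs_one, one_zpow, one_mul]
  have hb := abs_le.1 hu'
  have hnh : 2 * n * (π / (4 * n)) = π / 2 := by field_simp; norm_num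
  have hc0 : 0 ≤ cos (2 * n * u) := by
    refine cos_nonneg_of_mem_Icc ⟨?_, ?_⟩ <;> rw [← hnh] <;> nlinarith
  rw [hc, abs_of_nonneg hc0, Finset.mul_sum, Finset.mul_sum]
  refine Finset.sum_le_sum fun i hi => ?_
  have hi' : (i : ℝ) + 1 ≤ n := by exact_mod_cast Finset.mem_range.1 hi
  have hi0 : (0 : ℝ) ≤ i := i.cast_nonneg
  refine cos_mul_abs_cot_add_le hn hu' ?_ ?_
  · gcongr
    nlinarith
  · rw [← sub_nonneg]
    have : π / 2 - π / (4 * n) - (2 * i + 1) * π / (4 * n) = (n - (i + 1)) * π / (2 * n) := by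
      field_simp; ring
    rw [this]
    exact div_nonneg (mul_nonneg (by linarith) hπ.le) (by positivity)

/-! ### The cotangent sum at the origin -/

lemma cot_le_inv_sub {x : ℝ} (hx : 0 < x) (hx' : x < π) : cot x ≤ 1 / x - x / 3 := by
  have hs : 0 < sin x := sin_pos_of_pos_of_lt_pi hx hx'
  -- The function vanishes at 0 and has derivative y/3 · (sin y - y cos y) ≥ 0.
  have mono : MonotoneOn (fun y : ℝ => (1 - y ^ 2 / 3) * sin y - y * cos y) (Set.Icc 0 π) := by
    have hd (y : ℝ) : HasDerivAt (fun y : ℝ => (1 - y ^ 2 / 3) * sin y - y * cos y)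
        (y / 3 * (sin y - y * cos y)) y := by
      have h1 := ((((hasDerivAt_id y).pow 2).div_const 3).const_sub 1).mul (hasDerivAt_sin y)
      have h2 := (hasDerivAt_id y).mul (hasDerivAt_cos y)
      refine (h1.sub h2).congr_deriv ?_
      simp
      ring
    refine monotoneOn_of_deriv_nonneg (convex_Icc 0 π)
      (fun y _ => (hd y).continuousAt.continuousWithinAt)
      (fun y _ => (hd y).differentiableAt.differentiableWithinAt) fun y hy => ?_
    rw [interior_Icc] at hy
    rw [(hd y).deriv]
    have hsy : 0 < sin y := sin_pos_of_pos_of_lt_pi hy.1 hy.2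
    refine mul_nonneg (by linarith [hy.1]) ?_
    rcases lt_or_ge y (π / 2) with h | h
    · have hc : 0 < cos y := cos_pos_of_mem_Ioo ⟨by linarith [hy.1, pi_pos], h⟩
      have := (lt_tan hy.1 h).le
      rw [tan_eq_sin_div_cos, le_div_iff₀ hc] at this
      linarith
    · have hc : cos y ≤ 0 := cos_nonpos_of_pi_div_two_le_of_le h (by linarith [hy.2, pi_pos])
      nlinarith [hy.1]
  have := mono ⟨le_rfl, pi_pos.le⟩ ⟨hx.le, hx'.le⟩ hx.le
  simp only [sin_zero, mul_zero, zero_mul, sub_zero] at this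
  rw [cot_eq_cos_div_sin, div_le_iff₀ hs]
  have h3 : (1 / x - x / 3) * sin x = (1 - x ^ 2 / 3) * sin x / x := by field_simp
  rw [h3, le_div_iff₀ hx]
  linarith

/-- Equality holds at n = 2; the step is log(1 + t) ≥ 2t/(t + 2) at t = 1/n. Starting at n = 1 would
give the constant 1, too large for `sum_cot_le`. -/
lemma sum_inv_odd_le {n : ℕ} (hn : 2 ≤ n) :
    ∑ i ∈ Finset.range n, 1 / (2 * (i : ℝ) + 1) ≤ 1 / 2 * log n + (4 / 3 - 1 / 2 * log 2) := by
  induction n, hn using Nat.le_induction with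
  | base => norm_num [Finset.sum_range_succ]
  | succ n hn ih =>
    have hn' : (0 : ℝ) < n := by positivity
    rw [Finset.sum_range_succ]
    have key : 1 / (2 * (n : ℝ) + 1) ≤ 1 / 2 * (log (n + 1) - log n) := by
      rw [← log_div (by positivity) (by positivity)]
      have h := Real.le_log_one_add_of_nonneg (x := 1 / (n : ℝ)) (by positivity)
      have e1 : 1 + 1 / (n : ℝ) = (n + 1) / n := by field_simp
      have e2 : 2 * (1 / (n : ℝ)) / (1 / n + 2) = 2 * (1 / (2 * n + 1)) := by
        field_simp; ring
      rw [e1, e2] at h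
      linarith
    push_cast
    linarith

lemma sum_cot_le {n : ℕ} (hn : 0 < n) :
    (∑ i ∈ Finset.range n, cot ((2 * i + 1) * π / (4 * n))) / n ≤ 2 / π * log n + 1 := by
  have hπ := pi_pos
  rcases Nat.lt_or_ge n 2 with h | h
  · obtain rfl : n = 1 := by omega
    simp [cot_eq_cos_div_sin]
  have hn' : (0 : ℝ) < n := by exact_mod_cast hn
  have h1 : ∑ i ∈ Finset.range n, cot ((2 * i + 1) * π / (4 * n))
      ≤ ∑ i ∈ Finset.range n, (4 * n / π * (1 / (2 * (i : ℝ) + 1))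
        - π / (12 * n) * (2 * i + 1)) := by
    refine Finset.sum_le_sum fun i hi => ?_
    have hi' : (i : ℝ) + 1 ≤ n := by exact_mod_cast Finset.mem_range.1 hi
    refine (cot_le_inv_sub (by positivity) ?_).trans (le_of_eq ?_)
    · rw [div_lt_iff₀ (by positivity)]; nlinarith
    · field_simp; ring
  have h2 (k : ℕ) : ∑ i ∈ Finset.range k, (2 * (i : ℝ) + 1) = k ^ 2 := by
    induction k with
    | zero => simp
    | succ k ih => rw [Finset.sum_range_succ, ih]; push_cast; ring
  rw [Finset.sum_sub_distrib, ← Finset.mul_sum, ← Finset.mul_sum, h2] at h1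
  have h3 := sum_inv_odd_le h
  rw [div_le_iff₀ hn']
  refine h1.trans ?_
  have h4 : 4 * n / π * ∑ i ∈ Finset.range n, 1 / (2 * (i : ℝ) + 1)
      ≤ 4 * n / π * (1 / 2 * log n + (4 / 3 - 1 / 2 * log 2)) := by gcongr
  -- The left side is about 0.995; the term -π/12, coming from -x/3 in `cot_le_inv_sub`, is
  -- indispensable.
  have h5 : 4 / π * (4 / 3 - 1 / 2 * log 2) - π / 12 ≤ 1 := by
    rw [sub_le_iff_le_add, div_mul_eq_mul_div, div_le_iff₀ hπ]
    nlinarith [pi_gt_d4, log_two_gt_d9]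
  have h6 : π / (12 * n) * (n : ℝ) ^ 2 = n * (π / 12) := by field_simp
  rw [h6]
  have h7 := mul_le_mul_of_nonneg_left h5 hn'.le
  have h8 : 4 * n / π * (1 / 2 * log n + (4 / 3 - 1 / 2 * log 2))
      = 2 / π * log n * n + n * (4 / π * (4 / 3 - 1 / 2 * log 2)) := by field_simp; ring
  linarith

/-! ### Chebyshev nodes and their Lagrange basis -/

/-- The angle of the `i`th Chebyshev node. -/
def angle (N : ℕ) (i : Fin (N + 1)) : ℝ := (2 * ((i : ℕ) : ℝ) + 1) * π / (2 * ((N : ℝ) + 1))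

lemma coe_node (N : ℕ) (i : Fin (N + 1)) : (node N i : ℝ) = cos (angle N i) := rfl

lemma angle_pos (N : ℕ) (i : Fin (N + 1)) : 0 < angle N i := by
  have := pi_pos
  unfold angle; positivity

lemma angle_lt_pi (N : ℕ) (i : Fin (N + 1)) : angle N i < π := by
  have hi : ((i : ℕ) : ℝ) + 1 ≤ N + 1 := by exact_mod_cast i.2
  unfold angle
  rw [div_lt_iff₀ (by positivity)]
  nlinarith [pi_pos]

lemma succ_mul_angle (N : ℕ) (i : Fin (N + 1)) :
    ((N : ℝ) + 1) * angle N i = (i : ℕ) * π + π / 2 := by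
  unfold angle; field_simp

lemma angle_injective (N : ℕ) : Function.Injective (angle N) := by
  intro i j h
  have h1 := succ_mul_angle N i
  rw [h, succ_mul_angle] at h1
  have h2 : ((j : ℕ) : ℝ) = (i : ℕ) := mul_right_cancel₀ pi_ne_zero (add_right_cancel h1)
  exact Fin.ext (by exact_mod_cast h2.symm)

lemma node_injective (N : ℕ) : Function.Injective (node N) := by
  intro i j h
  have h1 : cos (angle N i) = cos (angle N j) := congrArg Subtype.val h
  exact angle_injective N (injOn_cos ⟨(angle_pos N i).le, (angle_lt_pi N i).le⟩
    ⟨(angle_pos N j).le, (angle_lt_pi N j).le⟩ h1)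

lemma coe_node_injective (N : ℕ) : Function.Injective (fun j => (node N j : ℝ)) :=
  Subtype.val_injective.comp (node_injective N)

lemma basis_apply (N : ℕ) (i : Fin (N + 1)) (x : I) :
    basis N i x = (Lagrange.basis Finset.univ (fun j => (node N j : ℝ)) i).eval (x : ℝ) := rfl

lemma interp_apply (N : ℕ) (f : C(I, ℝ)) (x : I) :
    interp N f x = ∑ i, f (node N i) * basis N i x := by
  simp [interp, ContinuousMap.sum_apply]

lemma basis_node (N : ℕ) (i j : Fin (N + 1)) : basis N i (node N j) = if i = j then 1 else 0 := by
  rw [basis_apply]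
  split_ifs with h
  · subst h
    exact Lagrange.eval_basis_self (coe_node_injective N).injOn (Finset.mem_univ _)
  · exact Lagrange.eval_basis_of_ne (v := fun j => (node N j : ℝ)) h (Finset.mem_univ _)

lemma sum_basis_eq_one (N : ℕ) (x : I) : ∑ i, basis N i x = 1 := by
  simp only [basis_apply]
  rw [← eval_finsetSum, Lagrange.sum_basis (coe_node_injective N).injOn Finset.univ_nonempty,
    eval_one]

/-- Interpolation reproduces polynomials of degree at most `N`. -/
lemma sum_eval_node_mul_basis (N : ℕ) (p : ℝ[X]) (hp : p.natDegree ≤ N) (x : I) :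
    ∑ i, p.eval (node N i : ℝ) * basis N i x = p.eval (x : ℝ) := by
  have h := Lagrange.eq_interpolate (s := Finset.univ) (coe_node_injective N).injOn (f := p) (by
    rw [Finset.card_univ, Fintype.card_fin]
    exact (degree_le_of_natDegree_le hp).trans_lt (by exact_mod_cast N.lt_succ_self))
  conv_rhs => rw [h]
  simp [Lagrange.interpolate_apply, eval_finsetSum, basis_apply]

/-- Both sides have degree N + 1, leading coefficient 2^N and the nodes as zeros. -/
lemma T_eq_nodal (N : ℕ) : Chebyshev.T ℝ ((N : ℤ) + 1) =
    C ((2 : ℝ) ^ N) * Lagrange.nodal Finset.univ (fun j => (node N j : ℝ)) := by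
  have hd : (Chebyshev.T ℝ ((N : ℤ) + 1)).degree = ((N + 1 : ℕ) : WithBot ℕ) := by
    rw [Chebyshev.degree_T]; rfl
  have hl : (Chebyshev.T ℝ ((N : ℤ) + 1)).leadingCoeff = 2 ^ N := by
    rw [Chebyshev.leadingCoeff_T]; rfl
  refine eq_of_degree_le_of_eval_index_eq (s := Finset.univ)
    (v := fun j => (node N j : ℝ)) (coe_node_injective N).injOn ?_ ?_ ?_ ?_
  · rw [hd]; simp
  · rw [hd, degree_C_mul (by positivity), Lagrange.degree_nodal]; simp
  · rw [hl, leadingCoeff_mul, leadingCoeff_C, (Lagrange.nodal_monic).leadingCoeff, mul_one]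
  · intro i _
    rw [eval_mul, Lagrange.eval_nodal_at_node (v := fun j => (node N j : ℝ)) (Finset.mem_univ i),
      mul_zero, coe_node,
      Chebyshev.T_real_cos]
    push_cast
    rw [succ_mul_angle, cos_add_pi_div_two, sin_nat_mul_pi, neg_zero]

/-- The Lagrange basis polynomial in terms of the Chebyshev polynomial of degree `N + 1`. -/
lemma basis_mul_eq (N : ℕ) (i : Fin (N + 1)) {x : I} {θ : ℝ} (hx : (x : ℝ) = cos θ) :
    basis N i x * (((N : ℝ) + 1) * (cos θ - cos (angle N i))) =
      (-1) ^ (i : ℕ) * sin (angle N i) * cos (((N : ℝ) + 1) * θ) := by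
  have hs : 0 < sin (angle N i) := sin_pos_of_pos_of_lt_pi (angle_pos N i) (angle_lt_pi N i)
  have hT : (Chebyshev.T ℝ ((N : ℤ) + 1)).eval (x : ℝ) = cos (((N : ℝ) + 1) * θ) := by
    rw [hx, Chebyshev.T_real_cos]; push_cast; rfl
  have hT' : (Chebyshev.T ℝ ((N : ℤ) + 1)).derivative.eval (node N i : ℝ) * sin (angle N i)
      = (N + 1) * (-1) ^ (i : ℕ) := by
    rw [Chebyshev.T_derivative_eq_U, add_sub_cancel_right, eval_mul, mul_assoc, coe_node,
      Chebyshev.U_real_cos]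
    have : (((N : ℤ) : ℝ) + 1) * angle N i = (i : ℕ) * π + π / 2 := by
      push_cast; exact succ_mul_angle N i
    rw [this, sin_add_pi_div_two, cos_nat_mul_pi]
    simp
  rcases eq_or_ne x (node N i) with rfl | hne
  · rw [coe_node] at hx
    rw [← hx, sub_self, mul_zero, mul_zero, ← hT, coe_node, Chebyshev.T_real_cos]
    push_cast
    rw [succ_mul_angle, cos_add_pi_div_two, sin_nat_mul_pi, neg_zero, mul_zero]
  have hne' : (x : ℝ) ≠ (node N i : ℝ) := fun h => hne (Subtype.ext h)
  have hw := Lagrange.nodalWeight_eq_eval_derivative_nodal (F := ℝ) (s := Finset.univ)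
    (v := fun j => (node N j : ℝ)) (Finset.mem_univ i)
  rw [basis_apply, Lagrange.eval_basis_not_at_node (v := fun j => (node N j : ℝ))
    (Finset.mem_univ _) hne', hw]
  rw [T_eq_nodal, eval_mul, eval_C] at hT
  rw [T_eq_nodal, derivative_C_mul, eval_mul, eval_C] at hT'
  set D := eval (node N i : ℝ) (derivative (Lagrange.nodal Finset.univ fun j => (node N j : ℝ)))
  have hD : D ≠ 0 := by
    rintro h0
    rw [h0, mul_zero, zero_mul] at hT'
    have : ((N : ℝ) + 1) * (-1) ^ (i : ℕ) ≠ 0 := mul_ne_zero (by positivity) (by simp)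
    exact this hT'.symm
  rw [← hT, ← coe_node, ← hx]
  have hsub : (x : ℝ) - node N i ≠ 0 := sub_ne_zero.2 hne'
  have hsq : ((-1 : ℝ) ^ (i : ℕ)) * (-1) ^ (i : ℕ) = 1 := by
    rw [← mul_pow]; simp
  field_simp
  linear_combination (eval (x : ℝ) (Lagrange.nodal Finset.univ fun j => (node N j : ℝ))) *
    (-(-1 : ℝ) ^ (i : ℕ)) * hT' -
    (eval (x : ℝ) (Lagrange.nodal Finset.univ fun j => (node N j : ℝ))) * (N + 1) * hsq

lemma exists_cos_eq (x : I) : ∃ θ : ℝ, (x : ℝ) = cos θ :=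
  ⟨arccos x, (cos_arccos x.2.1 x.2.2).symm⟩

/-! ### Lebesgue constants -/

/-- The Lebesgue function is bounded by the Lebesgue constant. -/
lemma sum_abs_basis_le (N : ℕ) (x : I) : ∑ i, |basis N i x| ≤ lebesgueConst N := by
  -- Tietze extension of the signs of the basis values at x gives a test function of norm at most 1
  -- whose interpolant at x is the Lebesgue function.
  obtain ⟨f, hf, hfi⟩ := BoundedContinuousFunction.exists_extension_norm_eq_of_isClosedEmbedding'
    (X := Fin (N + 1)) (Y := I)
    (BoundedContinuousFunction.mkOfDiscrete (fun i => (SignType.sign (basis N i x) : ℝ)) 2 (by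
      intro i j
      rw [Real.dist_eq]
      rcases SignType.sign (basis N i x) with _ | _ | _ <;>
      rcases SignType.sign (basis N j x) with _ | _ | _ <;> norm_num))
    ⟨node N, continuous_of_discreteTopology⟩
    (Topology.IsClosedEmbedding.of_continuous_injective_isClosedMap
      continuous_of_discreteTopology (node_injective N)
      (fun s _ => (s.toFinite.image _).isClosed))
  have hv (i) : f (node N i) = (SignType.sign (basis N i x) : ℝ) := by
    simpa using DFunLike.congr_fun hfi i
  have hnorm : ‖f.toContinuousMap‖ ≤ 1 := by
    rw [show ‖f.toContinuousMap‖ = ‖f‖ from rfl, hf,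
      BoundedContinuousFunction.norm_le zero_le_one]
    intro i
    simp only [BoundedContinuousFunction.mkOfDiscrete_apply]
    rcases SignType.sign (basis N i x) with _ | _ | _ <;> simp
  have h1 : interp N f.toContinuousMap x = ∑ i, |basis N i x| := by
    rw [interp_apply]
    refine Finset.sum_congr rfl fun i _ => ?_
    rw [← sign_mul_self, ← hv]; rfl
  rw [← h1]
  calc _ ≤ ‖interp N f.toContinuousMap x‖ := le_abs_self _
    _ ≤ ‖interp N f.toContinuousMap‖ := ContinuousMap.norm_coe_le_norm _ _
    _ ≤ ‖interp N‖ * ‖f.toContinuousMap‖ := (interp N).le_opNorm _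
    _ ≤ ‖interp N‖ * 1 := by gcongr
    _ = _ := mul_one _

lemma lebesgueConst_le {N : ℕ} {B : ℝ} (h : ∀ x, ∑ i, |basis N i x| ≤ B) :
    lebesgueConst N ≤ B := by
  have hB : 0 ≤ B := (Finset.sum_nonneg fun i _ => abs_nonneg _).trans (h ⟨0, by norm_num⟩)
  refine ContinuousLinearMap.opNorm_le_bound _ hB fun f => ?_
  rw [ContinuousMap.norm_le _ (by positivity)]
  intro x
  rw [interp_apply]
  refine (norm_sum_le _ _).trans ?_
  calc _ ≤ ∑ i, ‖f‖ * |basis N i x| := by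
        refine Finset.sum_le_sum fun i _ => ?_
        rw [norm_mul, Real.norm_eq_abs (basis N i x)]
        gcongr
        exact ContinuousMap.norm_coe_le_norm _ _
    _ = ‖f‖ * ∑ i, |basis N i x| := by rw [Finset.mul_sum]
    _ ≤ _ := by rw [mul_comm B]; gcongr; exact h x

/-- The basis sums to 1, but at x = 1 the basis polynomial of the second node is negative, so the
sum of absolute values is strictly larger. -/
lemma one_lt_lebesgueConst {N : ℕ} (hN : 1 ≤ N) : 1 < lebesgueConst N := by
  have hx : ((⟨1, by norm_num⟩ : I) : ℝ) = cos 0 := cos_zero.symm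
  refine lt_of_lt_of_le ?_ (sum_abs_basis_le N ⟨1, by norm_num⟩)
  refine (sum_basis_eq_one N ⟨1, by norm_num⟩).symm.le.trans_lt ?_
  refine Finset.sum_lt_sum (fun i _ => le_abs_self _)
    ⟨⟨1, by omega⟩, Finset.mem_univ _, ?_⟩
  have h := basis_mul_eq N ⟨1, by omega⟩ hx
  have hs := sin_pos_of_pos_of_lt_pi (angle_pos N ⟨1, by omega⟩) (angle_lt_pi N ⟨1, by omega⟩)
  rw [mul_zero, cos_zero, pow_one, mul_one] at h
  have hneg : basis N ⟨1, by omega⟩ ⟨1, by norm_num⟩ < 0 := by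
    by_contra hc
    have : 0 ≤ ((N : ℝ) + 1) * (1 - cos (angle N ⟨1, by omega⟩)) :=
      mul_nonneg (by positivity) (sub_nonneg.2 (cos_le_one _))
    have := mul_nonneg (not_lt.1 hc) this
    linarith
  exact hneg.trans_le (abs_nonneg _)

/-- The left side equals the absolute value of the difference of the two cotangents. -/
lemma two_mul_abs_sin_div_le {a θ : ℝ} (ha : 0 ≤ sin a) (h : cos θ ≠ cos a) :
    2 * (sin a / |cos θ - cos a|) ≤ |cot (θ / 2 + a / 2)| + |cot (θ / 2 - a / 2)| := by
  have e1 : cos θ - cos a = -2 * (sin (θ / 2 + a / 2) * sin (θ / 2 - a / 2)) := by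
    rw [cos_sub_cos]
    ring_nf
  have h1 : sin (θ / 2 + a / 2) ≠ 0 := fun h0 => h (sub_eq_zero.1 (by rw [e1, h0]; ring))
  have h2 : sin (θ / 2 - a / 2) ≠ 0 := fun h0 => h (sub_eq_zero.1 (by rw [e1, h0]; ring))
  have e2 : 2 * (sin a / |cos θ - cos a|)
      = |cot (θ / 2 + a / 2) - cot (θ / 2 - a / 2)| := by
    have e3 : sin a = sin (θ / 2 + a / 2) * cos (θ / 2 - a / 2)
        - cos (θ / 2 + a / 2) * sin (θ / 2 - a / 2) := by
      rw [← sin_sub]; ring_nf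
    rw [cot_eq_cos_div_sin, cot_eq_cos_div_sin, div_sub_div _ _ h1 h2, abs_div, e1,
      ← neg_sub (sin (θ / 2 + a / 2) * cos _), ← e3, abs_neg, abs_of_nonneg ha, abs_mul (-2)]
    norm_num
    have : |sin (θ / 2 + a / 2) * sin (θ / 2 - a / 2)| ≠ 0 := abs_ne_zero.2 (mul_ne_zero h1 h2)
    field_simp
  rw [e2]
  exact abs_sub _ _

lemma lebesgueConst_le_log (N : ℕ) :
    lebesgueConst N ≤ 2 / π * log ((N : ℝ) + 1) + 1 := by
  refine lebesgueConst_le fun x => ?_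
  have hlog : 0 ≤ log ((N : ℝ) + 1) := log_nonneg (by linarith [N.cast_nonneg (α := ℝ)])
  have hπ := pi_pos
  by_cases hx : ∃ j, x = node N j
  · obtain ⟨j, rfl⟩ := hx
    simp only [basis_node]
    rw [Finset.sum_eq_single j (by intro i _ h; simp [h]) (by simp), if_pos rfl, abs_one]
    have : 0 ≤ 2 / π * log ((N : ℝ) + 1) := by positivity
    linarith
  push Not at hx
  obtain ⟨θ, hθ⟩ := exists_cos_eq x
  have hn : (0 : ℝ) < (N : ℝ) + 1 := by positivity
  have hb (i : Fin (N + 1)) : |basis N i x| ≤ |cos (((N : ℝ) + 1) * θ)| / (2 * ((N : ℝ) + 1)) *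
      (|cot (θ / 2 + angle N i / 2)| + |cot (θ / 2 - angle N i / 2)|) := by
    have hs := sin_pos_of_pos_of_lt_pi (angle_pos N i) (angle_lt_pi N i)
    have hne : cos θ ≠ cos (angle N i) := fun h => hx i (Subtype.ext (by rw [hθ, h]; rfl))
    have h1 := congrArg abs (basis_mul_eq N i hθ)
    rw [abs_mul, abs_mul, abs_mul, abs_mul, abs_pow, abs_neg, abs_one, one_pow, one_mul,
      abs_of_pos hs, abs_of_pos hn] at h1
    have h2 : |basis N i x| = |cos (((N : ℝ) + 1) * θ)| / (2 * ((N : ℝ) + 1)) *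
        (2 * (sin (angle N i) / |cos θ - cos (angle N i)|)) := by
      have : |cos θ - cos (angle N i)| ≠ 0 := abs_ne_zero.2 (sub_ne_zero.2 hne)
      field_simp
      linarith
    rw [h2]
    gcongr
    exact two_mul_abs_sin_div_le hs.le hne
  refine (Finset.sum_le_sum fun i _ => hb i).trans ?_
  rw [← Finset.mul_sum]
  have h3 := abs_cos_mul_sum_abs_cot_le N.succ_pos (θ / 2)
  have h4 := sum_cot_le N.succ_pos
  have ha (i : Fin (N + 1)) : angle N i / 2 = (2 * ((i : ℕ) : ℝ) + 1) * π / (4 * (N.succ : ℕ)) := by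
    unfold angle; push_cast; field_simp; norm_num
  simp only [ha]
  rw [Fin.sum_univ_eq_sum_range (fun i : ℕ =>
    |cot (θ / 2 + (2 * (i : ℝ) + 1) * π / (4 * (N.succ : ℕ)))|
      + |cot (θ / 2 - (2 * (i : ℝ) + 1) * π / (4 * (N.succ : ℕ)))|) (N + 1)]
  rw [show 2 * ((N.succ : ℕ) : ℝ) * (θ / 2) = ((N : ℝ) + 1) * θ by push_cast; ring] at h3
  rw [show ((N.succ : ℕ) : ℝ) = (N : ℝ) + 1 by push_cast; rfl] at h3 h4 ⊢
  refine le_trans ?_ h4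
  rw [div_mul_eq_mul_div, div_le_div_iff₀ (by positivity) hn]
  have := mul_le_mul_of_nonneg_right h3 hn.le
  refine this.trans (le_of_eq ?_)
  ring

/-! ### Aliasing -/

/-- A shift of the frequency by 2(N+1)q adds q(2i+1)π to the argument, and the resulting sign does
not depend on i. -/
lemma cos_int_mul_angle_eq {N : ℕ} {k q r : ℤ} (h : k = 2 * (N + 1) * q + r) (i : Fin (N + 1)) :
    cos (k * angle N i) = (-1) ^ q * cos (r * angle N i) := by
  have h1 := succ_mul_angle N i
  have h2 : (k : ℝ) * angle N i = r * angle N i + ((q * (2 * (i : ℕ) + 1) : ℤ) : ℝ) * π := by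
    rw [h]
    push_cast
    linear_combination 2 * (q : ℝ) * h1
  rw [h2, cos_add_int_mul_pi, zpow_mul']
  congr 2
  rw [zpow_add₀ (by norm_num), zpow_mul]
  simp

/-- Interpolation reproduces `cos (k θ)` as a function of `cos θ` if `|k| ≤ N`. -/
lemma sum_cos_mul_basis_of_natAbs_le {N : ℕ} {k : ℤ} (hk : k.natAbs ≤ N) {x : I} {θ : ℝ}
    (hx : (x : ℝ) = cos θ) : ∑ i, cos (k * angle N i) * basis N i x = cos (k * θ) := by
  have h := sum_eval_node_mul_basis N (Chebyshev.T ℝ k) (by rwa [Chebyshev.natDegree_T]) x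
  simpa only [hx, coe_node, Chebyshev.T_real_cos] using h

/-- Aliasing: the interpolant of a Chebyshev polynomial of any degree is bounded by one. -/
lemma abs_sum_cos_mul_basis_le (N : ℕ) (k : ℤ) (x : I) :
    |∑ i, cos (k * angle N i) * basis N i x| ≤ 1 := by
  obtain ⟨θ, hθ⟩ := exists_cos_eq x
  -- With the remainder of least absolute value, |r| ≤ N is reproduced exactly, while |r| = N + 1
  -- gives a cosine vanishing at all nodes.
  obtain ⟨q, r, hqr, hr⟩ : ∃ q r : ℤ, k = 2 * (N + 1) * q + r ∧ r.natAbs ≤ N + 1 := by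
    have h : k = 2 * (N + 1) * (k / (2 * (N + 1))) + k % (2 * (N + 1)) :=
      (Int.mul_ediv_add_emod _ _).symm
    have h0 : 0 ≤ k % (2 * ((N : ℤ) + 1)) := Int.emod_nonneg _ (by omega)
    have h1 : k % (2 * ((N : ℤ) + 1)) < 2 * (N + 1) := Int.emod_lt_of_pos _ (by omega)
    rcases le_or_gt (k % (2 * ((N : ℤ) + 1))) (N + 1) with h2 | h2
    · exact ⟨_, _, h, by omega⟩
    · refine ⟨k / (2 * (N + 1)) + 1, k % (2 * (N + 1)) - 2 * (N + 1), ?_, by omega⟩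
      linear_combination h
  simp only [cos_int_mul_angle_eq hqr, mul_assoc]
  rw [← Finset.mul_sum, abs_mul, abs_zpow, abs_neg, abs_one, one_zpow, one_mul]
  rcases hr.lt_or_eq with h | h
  · rw [sum_cos_mul_basis_of_natAbs_le (by omega) hθ]
    exact abs_cos_le_one _
  · have h0 (i : Fin (N + 1)) : cos (r * angle N i) = 0 := by
      have h1 : |(r : ℝ)| = N + 1 := by
        rw [← Int.cast_abs, Int.abs_eq_natAbs, h]; push_cast; rfl
      rw [← cos_abs, abs_mul, h1, abs_of_pos (angle_pos N i), succ_mul_angle,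
        cos_add_pi_div_two, sin_nat_mul_pi, neg_zero]
    simp [h0]

/-! ### Decay of Chebyshev coefficients -/

/-- The contour is moved from radius 1 to any r < ρ; since nothing is assumed on |w| = ρ, the bound
there is a limit as r → ρ. -/
lemma norm_circleIntegral_inv_pow_mul_le {H : ℂ → ℂ} {ρ C : ℝ} (hρ : 1 < ρ)
    (hd : ∀ w : ℂ, 1 ≤ ‖w‖ → ‖w‖ < ρ → DifferentiableAt ℂ H w)
    (hb : ∀ w : ℂ, 1 ≤ ‖w‖ → ‖w‖ < ρ → ‖H w‖ ≤ C) (k : ℕ) :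
    ‖∮ w in C(0, 1), (w - 0)⁻¹ • ((w ^ k)⁻¹ * H w)‖ ≤ 2 * π * (C / ρ ^ k) := by
  have hr : ∀ r, 1 < r → r < ρ →
      ‖∮ w in C(0, 1), (w - 0)⁻¹ • ((w ^ k)⁻¹ * H w)‖ ≤ 2 * π * (C / r ^ k) := by
    intro r h1 h2
    have hr0 : 0 < r := one_pos.trans h1
    have hdiff : ∀ w : ℂ, 1 ≤ ‖w‖ → ‖w‖ < ρ →
        DifferentiableAt ℂ (fun w => (w ^ k)⁻¹ * H w) w := fun w hw hw' => by
      have hw0 : w ≠ 0 := norm_pos_iff.1 (one_pos.trans_le hw)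
      exact ((differentiableAt_id.pow k).inv (pow_ne_zero k hw0)).mul (hd w hw hw')
    rw [← Complex.circleIntegral_sub_center_inv_smul_eq_of_differentiable_on_annulus_off_countable
      (c := 0) one_pos h1.le Set.countable_empty]
    · refine (circleIntegral.norm_integral_le_of_norm_le_const (C := C / r ^ k / r) hr0.le
        fun w hw => ?_).trans (le_of_eq ?_)
      · have hw' : ‖w‖ = r := by simpa using hw
        rw [sub_zero, norm_smul, norm_mul, norm_inv, norm_inv, norm_pow, hw',
          div_eq_inv_mul, div_eq_inv_mul]
        have := hb w (by rw [hw']; exact h1.le) (by rw [hw']; exact h2)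
        gcongr
      · field_simp
    · intro w hw
      simp only [Set.mem_sdiff, Metric.mem_closedBall, Metric.mem_ball, dist_zero_right,
        not_lt] at hw
      exact (hdiff w hw.2 (hw.1.trans_lt h2)).continuousAt.continuousWithinAt
    · intro w hw
      simp only [Set.mem_sdiff, Metric.mem_closedBall, Metric.mem_ball, dist_zero_right,
        not_le] at hw
      exact hdiff w hw.1.2.le (hw.1.1.trans h2)
  have hlim : Filter.Tendsto (fun r : ℝ => 2 * π * (C / r ^ k)) (nhdsWithin ρ (Set.Iio ρ))
      (nhds (2 * π * (C / ρ ^ k))) := by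
    refine ContinuousAt.continuousWithinAt (f := fun r : ℝ => 2 * π * (C / r ^ k)) ?_
    have : ρ ^ k ≠ 0 := by positivity
    fun_prop (disch := assumption)
  refine ge_of_tendsto hlim ?_
  filter_upwards [Ioo_mem_nhdsLT hρ] with r h using hr r h.1 h.2

lemma fourierCoeff_neg_of_even {T : ℝ} [Fact (0 < T)] {h : AddCircle T → ℂ}
    (hh : ∀ t, h (-t) = h t) (n : ℤ) : fourierCoeff h (-n) = fourierCoeff h n := by
  unfold fourierCoeff
  rw [← integral_neg_eq_self]
  refine integral_congr_ae (Filter.Eventually.of_forall fun t => ?_)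
  simp only [hh, fourier_apply, smul_neg, neg_smul, neg_neg]

lemma mem_bernsteinEllipse {ρ : ℝ} {w : ℂ} (h1 : 1 ≤ ‖w‖) (h2 : ‖w‖ < ρ) :
    (w + w⁻¹) / 2 ∈ bernsteinEllipse ρ := ⟨w, ⟨h1, h2⟩, rfl⟩

lemma joukowski_exp (θ : ℝ) :
    (Complex.exp (θ * Complex.I) + (Complex.exp (θ * Complex.I))⁻¹) / 2 = (cos θ : ℂ) := by
  rw [← Complex.exp_neg, Complex.ofReal_cos, Complex.cos, neg_mul]

lemma cos_mem_bernsteinEllipse {ρ : ℝ} (hρ : 1 < ρ) (θ : ℝ) :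
    ((cos θ : ℝ) : ℂ) ∈ bernsteinEllipse ρ := by
  rw [← joukowski_exp]
  exact mem_bernsteinEllipse (by rw [Complex.norm_exp_ofReal_mul_I])
    (by rwa [Complex.norm_exp_ofReal_mul_I])

instance fact_two_pi_pos : Fact (0 < 2 * π) := ⟨two_pi_pos⟩

/-- The function `θ ↦ G (cos θ)` on the circle. -/
def cosLift (G : ℂ → ℂ) (t : AddCircle (2 * π)) : ℂ := G (Real.Angle.cos t)

lemma cosLift_coe (G : ℂ → ℂ) (θ : ℝ) : cosLift G (θ : AddCircle (2 * π)) = G (cos θ) := rfl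

lemma cosLift_neg (G : ℂ → ℂ) (t : AddCircle (2 * π)) : cosLift G (-t) = cosLift G t := by
  unfold cosLift
  exact congrArg (fun s : ℝ => G s) (Real.Angle.cos_neg t)

lemma continuous_cosLift {G : ℂ → ℂ} {ρ : ℝ} (hρ : 1 < ρ)
    (hG : AnalyticOnNhd ℂ G (bernsteinEllipse ρ)) : Continuous (cosLift G) := by
  rw [continuous_iff_continuousAt]
  intro t
  induction t using QuotientAddGroup.induction_on with
  | H θ =>
    have h1 : ContinuousAt G ((Real.Angle.cos (θ : Real.Angle) : ℝ) : ℂ) :=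
      (hG _ (cos_mem_bernsteinEllipse hρ θ)).continuousAt
    exact ContinuousAt.comp (g := G)
      (f := fun t : Real.Angle => ((Real.Angle.cos t : ℝ) : ℂ)) h1
      (Complex.continuous_ofReal.comp Real.Angle.continuous_cos).continuousAt

/-- Geometric decay of the Chebyshev coefficients of a function that is analytic and bounded
inside a Bernstein ellipse. -/
lemma norm_fourierCoeff_cosLift_le {G : ℂ → ℂ} {ρ C : ℝ} (hρ : 1 < ρ)
    (hG : AnalyticOnNhd ℂ G (bernsteinEllipse ρ)) (hb : ∀ z ∈ bernsteinEllipse ρ, ‖G z‖ ≤ C)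
    (n : ℤ) : ‖fourierCoeff (cosLift G) n‖ ≤ C / ρ ^ n.natAbs := by
  have hnat (k : ℕ) : ‖fourierCoeff (cosLift G) (k : ℤ)‖ ≤ C / ρ ^ k := by
    have h1 := norm_circleIntegral_inv_pow_mul_le (H := fun w => G ((w + w⁻¹) / 2)) hρ
      (fun w hw hw' => by
        have hw0 : w ≠ 0 := norm_pos_iff.1 (one_pos.trans_le hw)
        exact ((hG _ (mem_bernsteinEllipse hw hw')).differentiableAt).comp w
          ((differentiableAt_id.add (differentiableAt_inv hw0)).div_const 2))
      (fun w hw hw' => hb _ (mem_bernsteinEllipse hw hw')) k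
    -- Substituting w = exp(iθ), the Joukowski map becomes cos θ.
    have h2 : (∮ w in C(0, 1), (w - 0)⁻¹ • ((w ^ k)⁻¹ * G ((w + w⁻¹) / 2)))
        = (2 * π : ℝ) * Complex.I * fourierCoeff (cosLift G) (k : ℤ) := by
      rw [fourierCoeff_eq_intervalIntegral _ _ 0, zero_add, circleIntegral, Complex.real_smul]
      rw [mul_comm ((2 * π : ℝ) : ℂ), mul_assoc, ← mul_assoc _ (((1 / (2 * π) : ℝ)) : ℂ),
        ← Complex.ofReal_mul, mul_one_div_cancel two_pi_pos.ne', Complex.ofReal_one, one_mul,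
        ← intervalIntegral.integral_const_mul]
      refine intervalIntegral.integral_congr fun θ _ => ?_
      have hc : circleMap 0 1 θ = Complex.exp (θ * Complex.I) := by simp [circleMap]
      simp only [deriv_circleMap, hc, joukowski_exp, cosLift_coe, sub_zero, smul_eq_mul,
        fourier_coe_apply]
      have hne := Complex.exp_ne_zero (θ * Complex.I)
      have hf : Complex.exp (2 * π * Complex.I * ((-(k : ℤ) : ℤ) : ℂ) * θ / ((2 * π : ℝ) : ℂ))
          = (Complex.exp (θ * Complex.I) ^ k)⁻¹ := by
        rw [← Complex.exp_nat_mul, ← Complex.exp_neg]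
        congr 1
        have : (π : ℂ) ≠ 0 := by exact_mod_cast pi_ne_zero
        push_cast
        field_simp
      rw [hf]
      field_simp
    rw [h2, norm_mul, norm_mul, Complex.norm_I, mul_one, Complex.norm_real,
      Real.norm_of_nonneg two_pi_pos.le] at h1
    exact le_of_mul_le_mul_left h1 two_pi_pos
  obtain ⟨k, rfl | rfl⟩ := n.eq_nat_or_neg
  · simpa using hnat k
  · rw [fourierCoeff_neg_of_even (cosLift_neg G)]
    simpa using hnat k

/-! ### Univariate interpolation error -/

lemma hasSum_geometric_tail {r : ℝ} (h0 : 0 ≤ r) (h1 : r < 1) (N : ℕ) :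
    HasSum (fun n : ℕ => if n ≤ N then 0 else r ^ n) (r ^ (N + 1) / (1 - r)) := by
  rw [← hasSum_nat_add_iff' (N + 1)]
  have hz : ∑ i ∈ Finset.range (N + 1), (if i ≤ N then 0 else r ^ i) = 0 :=
    Finset.sum_eq_zero fun i hi => if_pos (by have := Finset.mem_range.1 hi; omega)
  rw [hz, sub_zero]
  have := (hasSum_geometric_of_lt_one h0 h1).mul_left (r ^ (N + 1))
  rw [div_eq_mul_inv]
  refine this.congr_fun fun n => ?_
  rw [if_neg (by omega), pow_add, mul_comm]

lemma hasSum_int_geometric_tail {r : ℝ} (h0 : 0 ≤ r) (h1 : r < 1) (N : ℕ) :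
    HasSum (fun n : ℤ => if n.natAbs ≤ N then 0 else r ^ n.natAbs)
      (2 * (r ^ (N + 1) / (1 - r))) := by
  have h := hasSum_geometric_tail h0 h1 N
  rw [two_mul]
  refine HasSum.of_nat_of_neg_add_one (f := fun n : ℤ => if n.natAbs ≤ N then 0 else r ^ n.natAbs)
    (by simpa using h) ?_
  have h' := (hasSum_nat_add_iff' 1).2 h
  simp only [Finset.range_one, Finset.sum_singleton, zero_le, if_true, sub_zero] at h'
  refine h'.congr_fun fun n => ?_
  have : (-((n : ℤ) + 1)).natAbs = n + 1 := by omega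
  simp only [this]

lemma abs_sub_sum_basis_le {f : I → ℝ} {G : ℂ → ℂ} {ρ C : ℝ} (hρ : 1 < ρ)
    (hG : AnalyticOnNhd ℂ G (bernsteinEllipse ρ)) (hb : ∀ z ∈ bernsteinEllipse ρ, ‖G z‖ ≤ C)
    (hf : ∀ t : I, G ((t : ℝ) : ℂ) = (f t : ℂ)) (N : ℕ) (x : I) :
    |f x - ∑ i, f (node N i) * basis N i x| ≤ 4 * C / ((ρ - 1) * ρ ^ N) := by
  obtain ⟨θ, hθ⟩ := exists_cos_eq x
  have hρ0 : 0 < ρ := one_pos.trans hρ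
  have hr0 : 0 ≤ ρ⁻¹ := inv_nonneg.2 hρ0.le
  have hr1 : ρ⁻¹ < 1 := inv_lt_one_of_one_lt₀ hρ
  have hC : 0 ≤ C := (norm_nonneg _).trans (hb _ (cos_mem_bernsteinEllipse hρ 0))
  set c : ℤ → ℂ := fourierCoeff (cosLift G) with hc
  have hcb (n : ℤ) : ‖c n‖ ≤ C * ρ⁻¹ ^ n.natAbs := by
    rw [inv_pow, ← div_eq_mul_inv]
    exact norm_fourierCoeff_cosLift_le hρ hG hb n
  have hsum : Summable c := by
    refine Summable.of_norm_bounded ?_ hcb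
    refine Summable.mul_left C ?_
    have hg := summable_geometric_of_lt_one hr0 hr1
    exact Summable.of_nat_of_neg (by simpa using hg) (by simpa using hg)
  -- Averaging the Fourier series at φ and -φ turns exponentials into cosines.
  have hF (φ : ℝ) : HasSum (fun n : ℤ => c n * (cos (n * φ) : ℂ)) (G (cos φ)) := by
    have hs (φ : ℝ) := has_pointwise_sum_fourier_series_of_summable
      (f := ⟨cosLift G, continuous_cosLift hρ hG⟩) hsum (φ : AddCircle (2 * π))
    have h1 := ((hs φ).add (hs (-φ))).mul_left (1 / 2)
    simp only [ContinuousMap.coe_mk, cosLift_coe, cos_neg] at h1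
    rw [← two_mul, ← mul_assoc, one_div, inv_mul_cancel₀ two_ne_zero, one_mul] at h1
    refine h1.congr_fun fun n => ?_
    simp only [fourier_coe_apply, smul_eq_mul]
    have hπ : (π : ℂ) ≠ 0 := by exact_mod_cast pi_ne_zero
    have e1 : 2 * π * Complex.I * (n : ℂ) * φ / ((2 * π : ℝ) : ℂ) = (n * φ : ℂ) * Complex.I := by
      push_cast; field_simp
    have e2 : 2 * π * Complex.I * (n : ℂ) * ((-φ : ℝ) : ℂ) / ((2 * π : ℝ) : ℂ)
        = -(n * φ : ℂ) * Complex.I := by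
      push_cast; field_simp
    rw [e1, e2, Complex.ofReal_cos, Complex.cos]
    push_cast
    ring
  have hE : HasSum (fun n : ℤ => c n * ((cos (n * θ) -
      ∑ i, cos (n * angle N i) * basis N i x : ℝ) : ℂ))
      ((f x - ∑ i, f (node N i) * basis N i x : ℝ) : ℂ) := by
    have h2 := (hF θ).sub (hasSum_sum fun (i : Fin (N + 1)) (_ : i ∈ Finset.univ) =>
      (hF (angle N i)).mul_right ((basis N i x : ℝ) : ℂ))
    have e3 : G (cos θ) - ∑ i, G (cos (angle N i)) * ((basis N i x : ℝ) : ℂ)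
        = ((f x - ∑ i, f (node N i) * basis N i x : ℝ) : ℂ) := by
      rw [← hθ, hf]
      simp only [← coe_node, hf]
      push_cast
      rfl
    rw [e3] at h2
    refine h2.congr_fun fun n => ?_
    push_cast
    rw [mul_sub, Finset.mul_sum]
    simp only [mul_assoc]
  -- C bounds the coefficients and 2 bounds a cosine minus its interpolant; the two-sided tail
  -- supplies the other factor 2.
  have hB := (hasSum_int_geometric_tail hr0 hr1 N).mul_left (2 * C)
  have hfin := hE.norm_le_of_bounded hB fun n => ?_
  · rw [Complex.norm_real, Real.norm_eq_abs] at hfin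
    refine hfin.trans (le_of_eq ?_)
    have : ρ - 1 ≠ 0 := (sub_pos.2 hρ).ne'
    have : 1 - ρ⁻¹ ≠ 0 := (sub_pos.2 hr1).ne'
    rw [show 1 - ρ⁻¹ = (ρ - 1) / ρ by field_simp, inv_pow]
    field_simp
    ring
  · rw [norm_mul, Complex.norm_real, Real.norm_eq_abs]
    split_ifs with h
    · rw [sum_cos_mul_basis_of_natAbs_le h hθ, sub_self, abs_zero, mul_zero, mul_zero]
    · have h3 : |cos (n * θ) - ∑ i, cos (n * angle N i) * basis N i x| ≤ 2 := by
        refine (abs_sub _ _).trans ?_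
        linarith [abs_cos_le_one (n * θ), abs_sum_cos_mul_basis_le N n x]
      calc _ ≤ C * ρ⁻¹ ^ n.natAbs * 2 :=
            mul_le_mul (hcb n) h3 (abs_nonneg _) (by positivity)
        _ = _ := by ring

/-! ### Tensorized interpolation -/

lemma grid_cons {m : ℕ} (N : Fin (m + 1) → ℕ) (i₀ : Fin (N 0 + 1))
    (i : (k : Fin m) → Fin (N k.succ + 1)) :
    grid N (Fin.cons i₀ i) = Fin.cons (node (N 0) i₀) (grid (fun k => N k.succ) i) := by
  funext k
  refine Fin.cases ?_ (fun k => ?_) k <;> simp [grid]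

lemma tensorInterp_succ {m : ℕ} (N : Fin (m + 1) → ℕ) (f : (Fin (m + 1) → I) → ℝ)
    (x : Fin (m + 1) → I) :
    tensorInterp N f x = ∑ i, tensorInterp (fun k => N k.succ)
      (fun y => f (Fin.cons (node (N 0) i) y)) (fun k => x k.succ) * basis (N 0) i (x 0) := by
  unfold tensorInterp
  rw [← (Fin.consEquiv fun k => Fin (N k + 1)).sum_comp, Fintype.sum_prod_type]
  refine Finset.sum_congr rfl fun i₀ _ => ?_
  rw [Finset.sum_mul]
  refine Finset.sum_congr rfl fun i _ => ?_
  rw [show Fin.consEquiv (fun k => Fin (N k + 1)) (i₀, i) = Fin.cons i₀ i from rfl, grid_cons,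
    Fin.prod_univ_succ]
  simp only [Fin.cons_zero, Fin.cons_succ]
  ring

lemma tensorInterp_add {m : ℕ} (N : Fin m → ℕ) (f g : (Fin m → I) → ℝ) (x : Fin m → I) :
    tensorInterp N (f + g) x = tensorInterp N f x + tensorInterp N g x := by
  simp [tensorInterp, add_mul, Finset.sum_add_distrib]

/-- Stated for bare nodal data, since g and e need not be continuous and the operator norm on
C([-1,1]) does not apply to them directly. -/
lemma abs_sum_mul_basis_le {N : ℕ} {a : Fin (N + 1) → ℝ} {B : ℝ} (ha : ∀ i, |a i| ≤ B) (x : I) :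
    |∑ i, a i * basis N i x| ≤ lebesgueConst N * B := by
  have hB : 0 ≤ B := (abs_nonneg _).trans (ha 0)
  calc _ ≤ ∑ i, |a i * basis N i x| := Finset.abs_sum_le_sum_abs _ _
    _ ≤ ∑ i, B * |basis N i x| := by
        refine Finset.sum_le_sum fun i _ => ?_
        rw [abs_mul]
        gcongr
        exact ha i
    _ = (∑ i, |basis N i x|) * B := by rw [← Finset.mul_sum, mul_comm]
    _ ≤ _ := by gcongr; exact sum_abs_basis_le N x

lemma abs_tensorInterp_le {m : ℕ} (N : Fin m → ℕ) (f : (Fin m → I) → ℝ) {B : ℝ}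
    (hf : ∀ i, |f (grid N i)| ≤ B) (x : Fin m → I) :
    |tensorInterp N f x| ≤ (∏ k, lebesgueConst (N k)) * B := by
  induction m with
  | zero =>
    simp only [tensorInterp, Finset.univ_unique, Finset.sum_singleton, Finset.univ_eq_empty,
      Finset.prod_empty, mul_one, one_mul]
    exact hf _
  | succ m ih =>
    rw [tensorInterp_succ, Fin.prod_univ_succ, mul_assoc]
    refine abs_sum_mul_basis_le (fun i => ih _ _ (fun j => ?_) _) _
    rw [← grid_cons]
    exact hf _

lemma prod_filter_lt_succ {m : ℕ} (a : Fin (m + 1) → ℝ) (k : Fin m) :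
    ∏ j ∈ Finset.univ.filter (fun j => j < k.succ), a j
      = a 0 * ∏ j ∈ Finset.univ.filter (fun j => j < k), a j.succ := by
  simp only [Finset.prod_filter, Fin.prod_univ_succ, Fin.succ_pos, if_true,
    Fin.succ_lt_succ_iff]

/-- Induction on the splitting (g - I₁g) + I₁(g - I'g). The hypothesis survives freezing the first
argument, and I₁ costs one factor of its Lebesgue constant. -/
lemma abs_sub_tensorInterp_le {m : ℕ} (N : Fin m → ℕ) (g : (Fin m → I) → ℝ) (B : Fin m → ℝ)
    (hg : ∀ k x t, |g (Function.update x k t)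
      - ∑ i, g (Function.update x k (node (N k) i)) * basis (N k) i t| ≤ B k)
    (x : Fin m → I) :
    |g x - tensorInterp N g x| ≤
      ∑ k, (∏ j ∈ Finset.univ.filter (fun j => j < k), lebesgueConst (N j)) * B k := by
  induction m with
  | zero =>
    have h : tensorInterp N g x = g x := by
      simp only [tensorInterp, Finset.univ_unique, Finset.sum_singleton, Finset.univ_eq_empty,
        Finset.prod_empty, mul_one]
      exact congrArg g (Subsingleton.elim _ _)
    simp [h]
  | succ m ih =>
    have h0 : |g x - ∑ i, g (Fin.cons (node (N 0) i) (Fin.tail x)) * basis (N 0) i (x 0)|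
        ≤ B 0 := by
      have hu (i) : (Fin.cons (node (N 0) i) (Fin.tail x) : Fin (m + 1) → I)
          = Function.update x 0 (node (N 0) i) := by
        conv_rhs => rw [← Fin.cons_self_tail x, Fin.update_cons_zero]
      simpa only [hu, Function.update_eq_self] using hg 0 x (x 0)
    have h1 : |∑ i, (g (Fin.cons (node (N 0) i) (Fin.tail x))
        - tensorInterp (fun k => N k.succ) (fun y => g (Fin.cons (node (N 0) i) y)) (Fin.tail x))
          * basis (N 0) i (x 0)| ≤ lebesgueConst (N 0) *
        ∑ k : Fin m, (∏ j ∈ Finset.univ.filter (fun j => j < k), lebesgueConst (N j.succ))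
          * B k.succ := by
      refine abs_sum_mul_basis_le (fun i => ih (fun k => N k.succ)
        (fun y => g (Fin.cons (node (N 0) i) y)) (fun k => B k.succ) (fun k y t => ?_) _) _
      simp only [Fin.cons_update]
      exact hg k.succ _ t
    have e : g x - tensorInterp N g x =
        (g x - ∑ i, g (Fin.cons (node (N 0) i) (Fin.tail x)) * basis (N 0) i (x 0)) +
        ∑ i, (g (Fin.cons (node (N 0) i) (Fin.tail x))
        - tensorInterp (fun k => N k.succ) (fun y => g (Fin.cons (node (N 0) i) y)) (Fin.tail x))
          * basis (N 0) i (x 0) := by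
      rw [tensorInterp_succ]
      simp only [sub_mul, Finset.sum_sub_distrib]
      rw [sub_add_sub_cancel]
      rfl
    rw [e]
    refine (abs_add_le _ _).trans ((add_le_add h0 h1).trans (le_of_eq ?_))
    rw [Fin.sum_univ_succ, Finset.mul_sum]
    congr 1
    · simp
    · refine Finset.sum_congr rfl fun k _ => ?_
      rw [prod_filter_lt_succ, mul_assoc]

lemma abs_sub_sum_update_le {m : ℕ} {g : (Fin m → I) → ℝ} {k : Fin m} {ρ C : ℝ} (hρ : 1 < ρ)
    (hg : HasBoundedContinuation g k ρ C) (N : ℕ) (x : Fin m → I) (t : I) :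
    |g (Function.update x k t) - ∑ i, g (Function.update x k (node N i)) * basis N i t|
      ≤ 4 * C / ((ρ - 1) * ρ ^ N) := by
  obtain ⟨G, hG, hb, hf⟩ := hg x
  exact abs_sub_sum_basis_le (f := fun t => g (Function.update x k t)) hρ hG hb hf N t

end ChebInterp

end

theorem mainTheorem5 (m : ℕ) (g e : (Fin m → ChebInterp.I) → ℝ)
    (N : Fin m → ℕ) (ρ C : Fin m → ℝ) (hρ : ∀ k, 1 < ρ k)
    (hg : ∀ k, ChebInterp.HasBoundedContinuation g k (ρ k) (C k)) :
    (∀ n : ℕ, ChebInterp.lebesgueConst n ≤ 2 / Real.pi * Real.log ((n : ℝ) + 1) + 1) ∧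
    (∀ x : Fin m → ChebInterp.I,
      |g x - ChebInterp.tensorInterp N (g + e) x| ≤
        (∑ k, 4 * (∏ j ∈ Finset.univ.filter (fun j => j < k), ChebInterp.lebesgueConst (N j)) * C k
            / ((ρ k - 1) * ρ k ^ N k))
          + (∏ k, ChebInterp.lebesgueConst (N k)) * ‖fun i => e (ChebInterp.grid N i)‖) ∧
    (∀ (N₀ : ℕ) (ρ₀ C₀ : ℝ), 1 ≤ N₀ → (∀ k, N k = N₀) → (∀ k, ρ k = ρ₀) → (∀ k, C k = C₀) →
      1 < ChebInterp.lebesgueConst N₀ ∧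
      ∀ x : Fin m → ChebInterp.I,
        |g x - ChebInterp.tensorInterp N (g + e) x| ≤
          4 * (ChebInterp.lebesgueConst N₀ ^ m - 1) * C₀
              / ((ρ₀ - 1) * ρ₀ ^ N₀ * (ChebInterp.lebesgueConst N₀ - 1))
            + ChebInterp.lebesgueConst N₀ ^ m * ‖fun i => e (ChebInterp.grid N i)‖) := by
  have main (x : Fin m → ChebInterp.I) : |g x - ChebInterp.tensorInterp N (g + e) x| ≤
        (∑ k, 4 * (∏ j ∈ Finset.univ.filter (fun j => j < k), ChebInterp.lebesgueConst (N j)) * C k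
            / ((ρ k - 1) * ρ k ^ N k))
          + (∏ k, ChebInterp.lebesgueConst (N k)) * ‖fun i => e (ChebInterp.grid N i)‖ := by
    have h1 := ChebInterp.abs_sub_tensorInterp_le N g _
      (fun k x t => ChebInterp.abs_sub_sum_update_le (hρ k) (hg k) (N k) x t) x
    have h2 := ChebInterp.abs_tensorInterp_le N e
      (B := ‖fun i => e (ChebInterp.grid N i)‖)
      (fun i => norm_le_pi_norm (fun i => e (ChebInterp.grid N i)) i) x
    rw [ChebInterp.tensorInterp_add, ← sub_sub]
    refine (abs_sub _ _).trans ((add_le_add h1 h2).trans (le_of_eq ?_))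
    congr 1
    refine Finset.sum_congr rfl fun k _ => ?_
    ring
  refine ⟨ChebInterp.lebesgueConst_le_log, main, fun N₀ ρ₀ C₀ h₀ hN hρ₀ hC => ?_⟩
  have hΛ := ChebInterp.one_lt_lebesgueConst h₀
  refine ⟨hΛ, fun x => (main x).trans (le_of_eq ?_)⟩
  simp only [hN, hρ₀, hC, Finset.prod_const, Finset.card_univ, Fintype.card_fin]
  congr 1
  have hcard (k : Fin m) : (Finset.univ.filter (fun j => j < k)).card = k := by
    rw [← Fin.card_Iio k]; congr 1; ext; simp
  simp only [hcard]
  -- A geometric sum, with ratio different from 1 by `one_lt_lebesgueConst`.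
  have hsum : ∑ k : Fin m, ChebInterp.lebesgueConst N₀ ^ (k : ℕ)
      = (ChebInterp.lebesgueConst N₀ ^ m - 1) / (ChebInterp.lebesgueConst N₀ - 1) := by
    rw [Fin.sum_univ_eq_sum_range (fun k => ChebInterp.lebesgueConst N₀ ^ k) m,
      geom_sum_eq hΛ.ne']
  rw [← Finset.sum_div, ← Finset.sum_mul, ← Finset.mul_sum, hsum]
  rw [mul_div_assoc', div_mul_eq_mul_div, div_div, mul_comm (ChebInterp.lebesgueConst N₀ - 1)]
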